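/- Let $H_n^{(r)}=\sum_{j=1}^n j^{-r}$ and $H_n=H_n^{(1)}$. For $m\ge 0$ let \[ P_m(y_1,\dots,y_m)=\sum_{m_1+2m_2+\cdots=m}\frac{(-1)^{m_2+m_4+\cdots}}{m_1!\,m_2!\cdots}\Bigl(\frac{y_1}{1}\Bigr)^{m_1}\Bigl(\frac{y_2}{2}\Bigr)^{m_2}\cdots, \qquad Q_m(y_1,\dots,y_m)=\sum_{m_1+2m_2+\cdots=m}\frac{1}{m_1!\,m_2!\cdots}\Bigl(\frac{y_1}{1}\Bigr)^{m_1}\Bigl(\frac{y_2}{2}\Bigr)^{m_2}\cdots, \] the polynomials that express the elementary symmetric function $e_m$ and the complete symmetric function $h_m$, respectively, in terms of the power sums $p_1,\dots,p_m$ (so $P_0=Q_0=1$). Let $\zeta$ be the Riemann zeta function, and put $\delta_{k,0}=1$ if $k=0$ and $\delta_{k,0}=0$ otherwise. Then for all nonnegative integers $k,l$ with $k+l\ge 1$ the following series converges, and \[ \sum_{n=1}^\infty\frac{Q_l(H_n,H_n^{(2)},\dots,H_n^{(l)})\,P_k(H_n,H_n^{(2)},\dots,H_n^{(k)})}{n(n+1)(n+2)}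 =\begin{cases} \frac12\Bigl[\Bigl(\binom{k+l+1}{k+1}-\delta_{k,0}\Bigr)\zeta(k+l+1)-\sum_{j=0}^{k}\binom{k+l-j}{k+1-j}\zeta(k+l-j)+\zeta(l)\Bigr],& l\ge 2,\\[4pt] \frac12\Bigl[(k+2-\delta_{k,0})\,\zeta(k+2)-\sum_{j=0}^{k-1}\zeta(k+1-j)-1\Bigr],& l=1,\\[4pt] \frac12\bigl(\zeta(k+1)-1\bigr),& l=0. \end{cases} \] -/

import Mathlib

noncomputable section

namespace HarmonicSum

/-- The generalized harmonic number `H_n^{(r)} = ∑_{j=1}^n 1 / j^r`. -/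
def genHarmonic (r n : ℕ) : ℝ :=
  ∑ j ∈ Finset.Icc 1 n, 1 / (j : ℝ) ^ r

/-- The polynomial `P_n(y_1, …, y_n)` with `e_n = P_n(p_1, …, p_n)`:
the sum, over all `(m_1, m_2, …)` with `m_1 + 2 m_2 + ⋯ = n`, of
`(-1)^{m_2 + m_4 + ⋯} / (m_1! m_2! ⋯) * (y_1 / 1)^{m_1} * (y_2 / 2)^{m_2} ⋯`.
The sequences `(m_i)` are the multiplicity sequences of the partitions of `n`.
The variable `y_i` is `MvPolynomial.X i`; the variable `X 0` does not occur. -/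
def P (n : ℕ) : MvPolynomial ℕ ℚ :=
  ∑ μ : n.Partition,
    (MvPolynomial.C
        ((-1 : ℚ) ^ (∑ i ∈ (Finset.Icc 1 n).filter (fun i => Even i), μ.parts.count i) /
          ∏ i ∈ Finset.Icc 1 n, ((μ.parts.count i).factorial : ℚ))) *
      ∏ i ∈ Finset.Icc 1 n,
        (MvPolynomial.C (1 / (i : ℚ)) * MvPolynomial.X i) ^ μ.parts.count i

/-- The polynomial `Q_n(y_1, …, y_n)` with `h_n = Q_n(p_1, …, p_n)`:
the same sum as for `P n`, without signs. -/
def Q (n : ℕ) : MvPolynomial ℕ ℚ :=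
  ∑ μ : n.Partition,
    (MvPolynomial.C (1 / ∏ i ∈ Finset.Icc 1 n, ((μ.parts.count i).factorial : ℚ))) *
      ∏ i ∈ Finset.Icc 1 n,
        (MvPolynomial.C (1 / (i : ℚ)) * MvPolynomial.X i) ^ μ.parts.count i

/-- `F(H_n, H_n^{(2)}, H_n^{(3)}, …)`: the value of the polynomial `F` at `y_i = H_n^{(i)}`. -/
def evalHarmonic (F : MvPolynomial ℕ ℚ) (n : ℕ) : ℝ :=
  MvPolynomial.aeval (fun i => genHarmonic i n) F

end HarmonicSum

end

noncomputable section

namespace HarmonicSum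

open PowerSeries Filter Topology
open scoped PowerSeries.WithPiTopology

/-! All `k` and `l` are treated at once by a generating function. Let `x` mark `Q_l` and `y` mark
`P_k`. At harmonic numbers these are `h_l` and `e_k` of `1, 1/2, …, 1/n`, so the generating function
is `A_n = ∏_{j ≤ n} (j + y) / (j - x)`, which is `shiftedProd 0 n`.

Two telescopings evaluate `∑ A_n / (n (n + 1) (n + 2))`. A connected sum in two indices
(`connectedTerm_sub`) gives `∑_{n ≥ 0} A_n / ((n + 1) (n + 1 - x)) = ∑_{m ≥ 1} 1 / ((m - x) (m - x -
y)) = Z`, whose coefficients are binomial multiples of zeta values. A one-index telescoping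
(`boundary_sub`) then gives `2 (1 - y) ∑ A_n / (n (n + 1) (n + 2)) = (x + y) (1 - x - y) Z - (x + y)
+ (1 - y) / 2`. Dividing by `2 (1 - y)` and reading off coefficients yields the three cases.

Convergence is coefficientwise in `ℝ⟦X⟧⟦X⟧`. Remainders have nonnegative coefficients and are
squeezed to zero, using the bound `H_n ^ (k + l)` on the coefficients of `A_n`. -/

/-! ### Partition sums and logarithmic derivatives -/

/-- The weight `∏ (z_i / i) ^ c / c!` summed over the partitions of `n` with multiplicities `c`. -/
def cycleSum (z : ℕ → ℝ) (n : ℕ) : ℝ :=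
  ∑ μ : n.Partition, ∏ i ∈ Finset.Icc 1 n,
    (z i / i) ^ μ.parts.count i / (μ.parts.count i).factorial

/-- The Euler operator `X d/dX` on power series. -/
def euler : ℝ⟦X⟧ →ₗ[ℝ] ℝ⟦X⟧ where
  toFun f := X * d⁄dX ℝ f
  map_add' f g := by rw [map_add, mul_add]
  map_smul' c f := by simp

theorem coeff_euler (f : ℝ⟦X⟧) (n : ℕ) : coeff n (euler f) = n * coeff n f := by
  cases n with
  | zero => simp [euler]
  | succ n =>
    simp only [euler, LinearMap.coe_mk, AddHom.coe_mk, coeff_succ_X_mul, coeff_derivative]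
    push_cast; ring

theorem euler_mul (f g : ℝ⟦X⟧) : euler (f * g) = euler f * g + f * euler g := by
  simp only [euler, LinearMap.coe_mk, AddHom.coe_mk, Derivation.leibniz, smul_eq_mul]
  ring

theorem continuous_euler : Continuous euler := by
  rw [continuous_iff_continuousAt]
  intro f
  rw [ContinuousAt, WithPiTopology.tendsto_iff_coeff_tendsto]
  intro d
  simp only [coeff_euler]
  exact ((WithPiTopology.continuous_coeff ℝ d).tendsto f).const_mul _

theorem euler_prod {ι : Type*} (s : Finset ι) (f p : ι → ℝ⟦X⟧)
    (h : ∀ i, euler (f i) = p i * f i) :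
    euler (∏ i ∈ s, f i) = (∑ i ∈ s, p i) * ∏ i ∈ s, f i := by
  classical
  induction s using Finset.induction_on with
  | empty => simp [euler]
  | insert a s ha ih =>
    rw [Finset.prod_insert ha, Finset.sum_insert ha, euler_mul, ih, h]
    ring

/-- Since `p` has no constant term, the equation in degree `n` expresses `n` times the `n`-th
coefficient through lower ones. -/
theorem eq_of_euler_eq_mul {p f g : ℝ⟦X⟧} (hp : coeff 0 p = 0)
    (hf : euler f = p * f) (hg : euler g = p * g) (h0 : coeff 0 f = coeff 0 g) : f = g := by
  ext n
  induction n using Nat.strong_induction_on with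
  | _ n ih =>
    rcases Nat.eq_zero_or_pos n with rfl | hn
    · exact h0
    · have key : (n : ℝ) * coeff n f = n * coeff n g := by
        rw [← coeff_euler, ← coeff_euler, hf, hg, coeff_mul, coeff_mul]
        refine Finset.sum_congr rfl fun a ha => ?_
        have hs := Finset.HasAntidiagonal.mem_antidiagonal.1 ha
        rcases Nat.eq_zero_or_pos a.1 with h | h
        · rw [h, hp, zero_mul, zero_mul]
        · rw [ih a.2 (by omega)]
      exact mul_left_cancel₀ (by positivity) key

/-- The power series `∑_{i ≥ 1} z_i X ^ i`. -/
def tailSeries (z : ℕ → ℝ) : ℝ⟦X⟧ := X * PowerSeries.mk fun i => z (i + 1)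

theorem coeff_zero_tailSeries (z : ℕ → ℝ) : coeff 0 (tailSeries z) = 0 := by
  simp [tailSeries]

theorem mk_cycleSum_eq_genFun (z : ℕ → ℝ) :
    PowerSeries.mk (cycleSum z) =
      Nat.Partition.genFun fun i c => (z i / i) ^ c / (c.factorial : ℝ) := by
  ext n
  rw [coeff_mk, Nat.Partition.coeff_genFun, cycleSum]
  refine Finset.sum_congr rfl fun μ _ => ?_
  rw [Finsupp.prod_of_support_subset (s := Finset.Icc 1 n)]
  · simp
  · intro i hi
    rw [Multiset.toFinsupp_support, Multiset.mem_toFinset] at hi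
    exact Finset.mem_Icc.2 ⟨μ.parts_pos hi, μ.le_of_mem_parts hi⟩
  · simp

/-- The factor is `exp (a X ^ (i + 1) / (i + 1))`, written with its constant term split off as in
`Nat.Partition.genFun`; its logarithmic Euler derivative is `a X ^ (i + 1)`. -/
theorem euler_exp_factor (a : ℝ) (i : ℕ) :
    euler (1 + ∑' j, ((a / (i + 1 : ℕ)) ^ (j + 1) / ((j + 1).factorial : ℝ)) •
        (X : ℝ⟦X⟧) ^ ((i + 1) * (j + 1))) =
      (a • X ^ (i + 1)) * (1 + ∑' j, ((a / (i + 1 : ℕ)) ^ (j + 1) / ((j + 1).factorial : ℝ)) •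
        (X : ℝ⟦X⟧) ^ ((i + 1) * (j + 1))) := by
  set g : ℕ → ℝ⟦X⟧ := fun j =>
    ((a / (i + 1 : ℕ)) ^ j / (j.factorial : ℝ)) • (X : ℝ⟦X⟧) ^ ((i + 1) * j) with hg
  have hs : Summable fun j => g (j + 1) :=
    Nat.Partition.summable_genFun_term (fun _ c => (a / (i + 1 : ℕ)) ^ c / (c.factorial : ℝ)) i
  have hs' : Summable g := (summable_nat_add_iff 1).1 hs
  have h1 : (1 + ∑' j, g (j + 1) : ℝ⟦X⟧) = ∑' j, g j := by
    rw [hs'.tsum_eq_zero_add]; simp [hg]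
  change euler (1 + ∑' j, g (j + 1)) = _ * (1 + ∑' j, g (j + 1))
  rw [h1]
  have hE : HasSum (fun j => euler (g j)) (euler (∑' j, g j)) :=
    hs'.hasSum.map euler continuous_euler
  have hstep : ∀ j, euler (g (j + 1)) = (a • X ^ (i + 1)) * g j := by
    intro j
    ext d
    rw [coeff_euler]
    simp only [hg, smul_mul_assoc, mul_smul_comm, ← pow_add, map_smul, coeff_X_pow, smul_eq_mul]
    have he : i + 1 + (i + 1) * j = (i + 1) * (j + 1) := by ring
    rw [he]
    split_ifs with h
    · subst h
      rw [Nat.factorial_succ]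
      have : (j.factorial : ℝ) ≠ 0 := by positivity
      push_cast
      field_simp
      rw [pow_succ]
      field_simp
    · simp
  have h2 : HasSum (fun j => euler (g (j + 1))) (euler (∑' j, g j)) := by
    have := (hasSum_nat_add_iff' 1).2 hE
    have h0 : euler (g 0) = 0 := by simp [hg, euler]
    simpa [h0] using this
  simp only [hstep] at h2
  exact h2.unique (hs'.hasSum.mul_left _)

/-- The series is an infinite product of exponentials. The identity holds for finite products by
`euler_prod` and passes to the limit because `euler` is continuous. -/
theorem euler_mk_cycleSum (z : ℕ → ℝ) :
    euler (PowerSeries.mk (cycleSum z)) = tailSeries z * PowerSeries.mk (cycleSum z) := by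
  rw [mk_cycleSum_eq_genFun]
  set f : ℕ → ℕ → ℝ := fun i c => (z i / i) ^ c / (c.factorial : ℝ) with hf
  have hp := (Nat.Partition.hasProd_genFun f).tendsto_prod_nat
  have hE := (continuous_euler.tendsto _).comp hp
  have hS : Tendsto (fun N => ∑ i ∈ Finset.range N, (z (i + 1) • (X : ℝ⟦X⟧) ^ (i + 1))) atTop
      (𝓝 (tailSeries z)) := by
    rw [WithPiTopology.tendsto_iff_coeff_tendsto]
    intro d
    refine tendsto_const_nhds.congr' ?_
    filter_upwards [eventually_ge_atTop d] with N hN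
    rw [map_sum]
    simp only [map_smul, coeff_X_pow, smul_eq_mul, mul_ite, mul_one, mul_zero]
    cases d with
    | zero => simp [tailSeries]
    | succ d =>
      simp only [tailSeries, coeff_succ_X_mul, coeff_mk, add_left_inj]
      rw [Finset.sum_ite_eq, if_pos (Finset.mem_range.2 (by omega))]
  refine tendsto_nhds_unique hE ((hS.mul hp).congr fun N => ?_)
  exact (euler_prod _ _ _ fun i => euler_exp_factor (z (i + 1)) i).symm

theorem cycleSum_zero (z : ℕ → ℝ) : cycleSum z 0 = 1 := by
  simp [cycleSum]

theorem evalHarmonic_Q (l n : ℕ) :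
    evalHarmonic (Q l) n = cycleSum (fun i => genHarmonic i n) l := by
  simp only [evalHarmonic, Q, cycleSum, map_sum, map_mul, map_prod, map_pow,
    MvPolynomial.aeval_C, MvPolynomial.aeval_X]
  refine Finset.sum_congr rfl fun μ _ => ?_
  simp [div_eq_inv_mul, Finset.prod_mul_distrib]

theorem evalHarmonic_P (k n : ℕ) :
    evalHarmonic (P k) n = cycleSum (fun i => (-1) ^ (i + 1) * genHarmonic i n) k := by
  simp only [evalHarmonic, P, cycleSum, map_sum, map_mul, map_prod, map_pow,
    MvPolynomial.aeval_C, MvPolynomial.aeval_X]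
  refine Finset.sum_congr rfl fun μ _ => ?_
  have hs : ∏ i ∈ Finset.Icc 1 k, (((-1 : ℝ) ^ (i + 1)) ^ μ.parts.count i) =
      (-1) ^ (∑ i ∈ (Finset.Icc 1 k).filter (fun i => Even i), μ.parts.count i) := by
    rw [← Finset.prod_pow_eq_pow_sum, Finset.prod_filter]
    refine Finset.prod_congr rfl fun i _ => ?_
    split_ifs with h
    · rw [(Even.add_one h).neg_one_pow]
    · rw [(Nat.not_even_iff_odd.1 h).add_one.neg_one_pow, one_pow]
  simp_rw [mul_div_assoc, mul_pow]
  simp_rw [mul_div_assoc]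
  rw [Finset.prod_mul_distrib (f := fun i => ((-1 : ℝ) ^ (i + 1)) ^ μ.parts.count i), hs]
  simp only [div_eq_inv_mul, map_mul, map_inv₀, map_prod, map_pow, map_neg, map_one, map_natCast,
    Finset.prod_mul_distrib, mul_pow, mul_one, Finset.prod_inv_distrib]
  ring

/-! ### Generating products of the complete and elementary symmetric functions -/

/-- The power series `1 / (c - X)`. -/
def geomInv (c : ℝ) : ℝ⟦X⟧ := PowerSeries.mk fun l => (1 / c) ^ (l + 1)

theorem sub_mul_geomInv {c : ℝ} (hc : c ≠ 0) : (C c - X) * geomInv c = 1 := by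
  ext n
  rw [sub_mul, map_sub, coeff_C_mul, geomInv, coeff_mk]
  cases n with
  | zero => simp [hc]
  | succ n =>
    rw [coeff_succ_X_mul, coeff_mk, coeff_one, if_neg (by omega)]
    rw [pow_succ (1 / c) (n + 1)]
    field_simp
    ring

theorem euler_geomInv {c : ℝ} (hc : c ≠ 0) : euler (geomInv c) = X * geomInv c * geomInv c := by
  have h := sub_mul_geomInv hc
  have h1 : d⁄dX ℝ ((C c - X) * geomInv c) = 0 := by rw [h]; simp
  rw [Derivation.leibniz] at h1
  simp only [map_sub, derivative_C, derivative_X, smul_eq_mul] at h1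
  change X * d⁄dX ℝ (geomInv c) = _
  linear_combination X * geomInv c * h1 - X * (d⁄dX ℝ (geomInv c)) * h

/-- The generating function `∏_{j ≤ n} (1 - X / j)⁻¹` of the complete symmetric functions. -/
def completeSeries (n : ℕ) : ℝ⟦X⟧ :=
  ∏ j ∈ Finset.range n, C ((j : ℝ) + 1) * geomInv (j + 1)

/-- The generating function `∏_{j ≤ n} (1 + X / j)` of the elementary symmetric functions. -/
def elementarySeries (n : ℕ) : ℝ⟦X⟧ :=
  ∏ j ∈ Finset.range n, (1 + C (1 / ((j : ℝ) + 1)) * X)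

theorem genHarmonic_eq_sum_range (r n : ℕ) :
    genHarmonic r n = ∑ j ∈ Finset.range n, (1 / ((j : ℝ) + 1)) ^ r := by
  induction n with
  | zero => simp [genHarmonic]
  | succ n ih =>
    rw [Finset.sum_range_succ, ← ih, genHarmonic, Finset.sum_Icc_succ_top (by omega)]
    simp [genHarmonic]

/-- Newton's identities in generating form: the logarithmic Euler derivative of the product is `∑_j
X / (j - X)`, the power sum series. -/
theorem completeSeries_eq (n : ℕ) :
    completeSeries n = PowerSeries.mk (cycleSum fun i => genHarmonic i n) := by
  have hsum : ∑ j ∈ Finset.range n, X * geomInv ((j : ℝ) + 1) =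
      tailSeries fun i => genHarmonic i n := by
    rw [tailSeries, ← Finset.mul_sum]
    congr 1
    ext l
    simp [geomInv, genHarmonic_eq_sum_range]
  refine eq_of_euler_eq_mul (coeff_zero_tailSeries _) ?_ (euler_mk_cycleSum _) ?_
  · rw [← hsum, completeSeries]
    refine euler_prod _ _ _ fun j => ?_
    rw [← smul_eq_C_mul, map_smul, euler_geomInv (by positivity)]
    simp only [smul_eq_C_mul]; ring
  · rw [coeff_mk, cycleSum_zero, completeSeries, coeff_zero_eq_constantCoeff_apply, map_prod]
    refine Finset.prod_eq_one fun j _ => ?_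
    rw [map_mul, constantCoeff_C, ← coeff_zero_eq_constantCoeff_apply, geomInv, coeff_mk,
      zero_add, pow_one, mul_one_div_cancel (by positivity)]

theorem elementarySeries_eq (n : ℕ) :
    elementarySeries n =
      PowerSeries.mk (cycleSum fun i => (-1) ^ (i + 1) * genHarmonic i n) := by
  have hsum : ∑ j ∈ Finset.range n, -(X * geomInv (-((j : ℝ) + 1))) =
      tailSeries fun i => (-1) ^ (i + 1) * genHarmonic i n := by
    rw [tailSeries, Finset.sum_neg_distrib, ← Finset.mul_sum, ← mul_neg]
    congr 1
    ext l
    simp only [map_neg, map_sum, geomInv, coeff_mk, genHarmonic_eq_sum_range, Finset.mul_sum,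
      ← Finset.sum_neg_distrib]
    refine Finset.sum_congr rfl fun j _ => ?_
    rw [one_div_neg_eq_neg_one_div, neg_pow]
    ring
  refine eq_of_euler_eq_mul (coeff_zero_tailSeries _) ?_ (euler_mk_cycleSum _) ?_
  · rw [← hsum, elementarySeries]
    refine euler_prod _ _ _ fun j => ?_
    have hj : (j : ℝ) + 1 ≠ 0 := by positivity
    have h := sub_mul_geomInv (neg_ne_zero.2 hj)
    have hC : C (1 / ((j : ℝ) + 1)) * C ((j : ℝ) + 1) = (1 : ℝ⟦X⟧) := by
      rw [← map_mul, one_div_mul_cancel hj, map_one]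
    have hd : euler (1 + C (1 / ((j : ℝ) + 1)) * X) = C (1 / ((j : ℝ) + 1)) * X := by
      rw [← smul_eq_C_mul, map_add, map_smul]
      simp [euler]
    rw [hd]
    rw [map_neg] at h
    linear_combination (-C (1 / ((j : ℝ) + 1)) * X) * h - X * geomInv (-((j : ℝ) + 1)) * hC
  · rw [coeff_mk, cycleSum_zero, elementarySeries, coeff_zero_eq_constantCoeff_apply, map_prod]
    exact Finset.prod_eq_one fun j _ => by simp

theorem evalHarmonic_Q_eq_coeff (l n : ℕ) :
    evalHarmonic (Q l) n = coeff l (completeSeries n) := by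
  rw [evalHarmonic_Q, completeSeries_eq, coeff_mk]

theorem evalHarmonic_P_eq_coeff (k n : ℕ) :
    evalHarmonic (P k) n = coeff k (elementarySeries n) := by
  rw [evalHarmonic_P, elementarySeries_eq, coeff_mk]

/-! ### Double power series and the two telescoping identities -/

/-- The inner variable of `ℝ⟦X⟧⟦X⟧`, which marks the complete symmetric functions. -/
def xVar : ℝ⟦X⟧⟦X⟧ := C X

/-- The outer variable of `ℝ⟦X⟧⟦X⟧`, which marks the elementary symmetric functions. -/
def yVar : ℝ⟦X⟧⟦X⟧ := X

/-- The embedding of the real numbers as constant double power series. -/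
def scalar : ℝ →+* ℝ⟦X⟧⟦X⟧ := (C : ℝ⟦X⟧ →+* ℝ⟦X⟧⟦X⟧).comp (C : ℝ →+* ℝ⟦X⟧)

/-- The constant `1 / (n + 1)`. -/
def recip (n : ℕ) : ℝ⟦X⟧⟦X⟧ := scalar (1 / ((n : ℝ) + 1))

/-- The double power series `1 / (n + 1 - x)`. -/
def pole (n : ℕ) : ℝ⟦X⟧⟦X⟧ := C (geomInv ((n : ℝ) + 1))

/-- The double power series `1 / ((n + 1 - x) (n + 1 - x - y))`. -/
def doublePole (n : ℕ) : ℝ⟦X⟧⟦X⟧ := PowerSeries.mk fun k => geomInv ((n : ℝ) + 1) ^ (k + 2)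

/-- The product `∏_{j < N} (j + 1 + y) / (m + j + 1 - x)`. -/
def shiftedProd (m N : ℕ) : ℝ⟦X⟧⟦X⟧ :=
  ∏ j ∈ Finset.range N, ((j : ℝ⟦X⟧⟦X⟧) + 1 + yVar) * pole (m + j)

theorem add_one_mul_recip (n : ℕ) : ((n : ℝ⟦X⟧⟦X⟧) + 1) * recip n = 1 := by
  have h : scalar ((n : ℝ) + 1) * recip n = 1 := by
    rw [recip, ← map_mul, mul_one_div_cancel (by positivity), map_one]
  simpa using h

theorem sub_mul_pole (n : ℕ) : ((n : ℝ⟦X⟧⟦X⟧) + 1 - xVar) * pole n = 1 := by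
  have h := congrArg (C : ℝ⟦X⟧ →+* ℝ⟦X⟧⟦X⟧)
    (sub_mul_geomInv (show (n : ℝ) + 1 ≠ 0 by positivity))
  simpa [xVar, pole] using h

theorem sub_mul_doublePole (n : ℕ) :
    ((n : ℝ⟦X⟧⟦X⟧) + 1 - xVar - yVar) * doublePole n = pole n := by
  have h : (((n : ℝ⟦X⟧) + 1) - X) * geomInv ((n : ℝ) + 1) = 1 := by
    simpa using sub_mul_geomInv (show (n : ℝ) + 1 ≠ 0 by positivity)
  have hC : ((n : ℝ⟦X⟧⟦X⟧) + 1 - xVar - yVar) = C ((n : ℝ⟦X⟧) + 1 - X) - X := by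
    simp [xVar, yVar]
  rw [hC, sub_mul]
  ext1 k
  rw [map_sub, coeff_C_mul, pole, doublePole, coeff_mk, coeff_C]
  cases k with
  | zero =>
    rw [coeff_zero_X_mul, if_pos rfl]
    linear_combination geomInv ((n : ℝ) + 1) * h
  | succ k =>
    rw [coeff_succ_X_mul, coeff_mk, if_neg (by omega)]
    linear_combination geomInv ((n : ℝ) + 1) ^ (k + 2) * h

theorem shiftedProd_succ (m N : ℕ) : shiftedProd m (N + 1) =
    shiftedProd m N * (((N : ℝ⟦X⟧⟦X⟧) + 1 + yVar) * pole (m + N)) :=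
  Finset.prod_range_succ _ _

/-- Both sides have the same numerator and the poles of index `m, …, m + N`. -/
theorem shiftedProd_succ_mul_pole (m N : ℕ) :
    shiftedProd (m + 1) N * pole m = shiftedProd m N * pole (m + N) := by
  induction N with
  | zero => simp [shiftedProd]
  | succ N ih =>
    rw [shiftedProd_succ, shiftedProd_succ, show m + 1 + N = m + (N + 1) by omega]
    linear_combination ((N : ℝ⟦X⟧⟦X⟧) + 1 + yVar) * pole (m + (N + 1)) * ih

/-- The summand of the connected sum that is telescoped in both indices. -/
def connectedTerm (n m : ℕ) : ℝ⟦X⟧⟦X⟧ := recip n * shiftedProd (m + 1) n * pole m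

theorem connectedTerm_sub (n m : ℕ) :
    connectedTerm n m - connectedTerm n (m + 1) =
      doublePole m * shiftedProd (m + 1) n - doublePole m * shiftedProd (m + 1) (n + 1) := by
  have h1 := shiftedProd_succ_mul_pole (m + 1) n
  have h2 := shiftedProd_succ (m + 1) n
  have hv := sub_mul_doublePole m
  have hm := sub_mul_pole m
  have hk := sub_mul_pole (m + 1 + n)
  have hr := add_one_mul_recip n
  push_cast at hk
  simp only [connectedTerm]
  set B := shiftedProd (m + 1) n
  set w := pole m
  set w' := pole (m + 1 + n)
  set v := doublePole m
  set r := recip n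
  -- Partial fractions: the two denominators `m + 1 - x` and `m + n + 2 - x` differ by `n + 1`,
  -- which cancels against `recip n`.
  have hw : w - w' = ((n : ℝ⟦X⟧⟦X⟧) + 1) * w * w' := by
    linear_combination w' * hm - w * hk
  have hv' : v * (1 - ((n : ℝ⟦X⟧⟦X⟧) + 1 + yVar) * w') = w * w' := by
    linear_combination w' * hv - v * hk
  rw [h2]
  linear_combination (-r) * h1 + r * B * hw + B * w * w' * hr - B * hv'

theorem sum_connectedTerm_sub (N m : ℕ) :
    ∑ n ∈ Finset.range N, connectedTerm n m - ∑ n ∈ Finset.range N, connectedTerm n (m + 1) =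
      doublePole m - doublePole m * shiftedProd (m + 1) N := by
  rw [← Finset.sum_sub_distrib]
  simp_rw [connectedTerm_sub]
  rw [Finset.sum_range_sub']
  simp [shiftedProd]

/-- Exact remainder of the connected sum on the rectangle `n < N`, `m < M`. The limits `M → ∞` and
then `N → ∞` are taken from this identity. -/
theorem sum_doublePole_mul (N M : ℕ) :
    ∑ m ∈ Finset.range M, doublePole m * shiftedProd (m + 1) N =
      ∑ m ∈ Finset.range M, doublePole m - (∑ n ∈ Finset.range N, connectedTerm n 0 -
        ∑ n ∈ Finset.range N, connectedTerm n M) := by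
  rw [← Finset.sum_range_sub' (fun m => ∑ n ∈ Finset.range N, connectedTerm n m) M]
  simp_rw [sum_connectedTerm_sub]
  rw [Finset.sum_sub_distrib]
  ring

/-- The boundary term in the telescoping of the series with denominators `n (n + 1) (n + 2)`. -/
def boundary (n : ℕ) : ℝ⟦X⟧⟦X⟧ :=
  shiftedProd 0 n * recip n * (xVar + yVar - (1 - yVar) * recip (n + 1))

theorem boundary_sub (n : ℕ) :
    boundary (n + 1) - boundary n =
      2 * (1 - yVar) * (shiftedProd 0 (n + 1) * recip n * recip (n + 1) * recip (n + 2)) -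
        (xVar + yVar) * (1 - xVar - yVar) * connectedTerm n 0 := by
  have h1 := shiftedProd_succ_mul_pole 0 n
  have h2 := shiftedProd_succ 0 n
  have hw := sub_mul_pole n
  have hr := add_one_mul_recip n
  have hr1 := add_one_mul_recip (n + 1)
  have hr2 := add_one_mul_recip (n + 2)
  simp only [zero_add] at h1 h2
  push_cast at hr1 hr2
  -- Every term is now a multiple of `shiftedProd 0 n`; what remains is a rational function identity
  -- in `n`, `x`, `y`.
  rw [boundary, boundary, connectedTerm, zero_add, mul_assoc (recip n), h1, h2]
  generalize shiftedProd 0 n = A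
  generalize pole n = w at *
  generalize recip n = r at *
  generalize recip (n + 1) = r' at *
  generalize recip (n + 2) = r'' at *
  generalize xVar = x at *
  generalize yVar = y at *
  generalize (n : ℝ⟦X⟧⟦X⟧) = a at *
  grind

theorem two_mul_sum_shiftedProd (N : ℕ) :
    2 * (1 - yVar) *
      ∑ n ∈ Finset.range N, shiftedProd 0 (n + 1) * recip n * recip (n + 1) * recip (n + 2) =
    (xVar + yVar) * (1 - xVar - yVar) * ∑ n ∈ Finset.range N, connectedTerm n 0 +
      (boundary N - boundary 0) := by
  rw [← Finset.sum_range_sub]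
  simp_rw [boundary_sub]
  rw [Finset.sum_sub_distrib, Finset.mul_sum, Finset.mul_sum]
  ring

/-! ### Coefficientwise convergence and positivity -/

theorem tendsto_iff_coeff_coeff {ι : Type*} {F : Filter ι} {f : ι → ℝ⟦X⟧⟦X⟧} {g : ℝ⟦X⟧⟦X⟧} :
    Tendsto f F (𝓝 g) ↔
      ∀ k l, Tendsto (fun i => coeff l (coeff k (f i))) F (𝓝 (coeff l (coeff k g))) := by
  rw [WithPiTopology.tendsto_iff_coeff_tendsto]
  exact forall_congr' fun k => WithPiTopology.tendsto_iff_coeff_tendsto _ _ _ _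

/-- The double power series with nonnegative coefficients. -/
def nonnegCoeffs : Subsemiring ℝ⟦X⟧⟦X⟧ where
  carrier := {f | ∀ k l, 0 ≤ coeff l (coeff k f)}
  mul_mem' {f g} hf hg k l := by
    rw [coeff_mul, map_sum]
    refine Finset.sum_nonneg fun a _ => ?_
    rw [coeff_mul]
    exact Finset.sum_nonneg fun b _ => mul_nonneg (hf _ _) (hg _ _)
  one_mem' k l := by
    simp only [coeff_one, apply_ite (coeff l), map_zero]
    split_ifs <;> norm_num
  add_mem' {f g} hf hg k l := by
    rw [map_add, map_add]
    exact add_nonneg (hf k l) (hg k l)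
  zero_mem' k l := by simp

theorem coeff_geomInv (c : ℝ) (l : ℕ) : coeff l (geomInv c) = (1 / c) ^ (l + 1) := coeff_mk _ _

theorem coeff_coeff_pole (n k l : ℕ) :
    coeff l (coeff k (pole n)) = if k = 0 then (1 / ((n : ℝ) + 1)) ^ (l + 1) else 0 := by
  rw [pole, coeff_C]
  split_ifs
  · exact coeff_geomInv _ _
  · simp

theorem pole_mem (n : ℕ) : pole n ∈ nonnegCoeffs := by
  intro k l
  rw [coeff_coeff_pole]
  split_ifs <;> positivity

theorem pole_sub_pole_mem {m n : ℕ} (h : m ≤ n) : pole m - pole n ∈ nonnegCoeffs := by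
  intro k l
  rw [map_sub, map_sub, coeff_coeff_pole, coeff_coeff_pole]
  split_ifs
  · have : (m : ℝ) ≤ n := by exact_mod_cast h
    rw [sub_nonneg]
    gcongr
  · simp

theorem yVar_mem : yVar ∈ nonnegCoeffs := by
  intro k l
  simp only [yVar, coeff_X, apply_ite (coeff l), map_zero, coeff_one]
  split_ifs <;> norm_num

theorem factor_mem (j : ℕ) : (j : ℝ⟦X⟧⟦X⟧) + 1 + yVar ∈ nonnegCoeffs :=
  add_mem (add_mem (natCast_mem _ _) (one_mem _)) yVar_mem

theorem shiftedProd_mem (m N : ℕ) : shiftedProd m N ∈ nonnegCoeffs :=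
  prod_mem fun j _ => mul_mem (factor_mem j) (pole_mem _)

/-- The coefficients of each pole decrease in its index, and products of nonnegative series preserve
this comparison. -/
theorem shiftedProd_sub_mem {m n : ℕ} (h : m ≤ n) (N : ℕ) :
    shiftedProd m N - shiftedProd n N ∈ nonnegCoeffs := by
  induction N with
  | zero => simp [shiftedProd, zero_mem]
  | succ N ih =>
    have e : shiftedProd m (N + 1) - shiftedProd n (N + 1) =
        ((N : ℝ⟦X⟧⟦X⟧) + 1 + yVar) * ((shiftedProd m N - shiftedProd n N) * pole (m + N) +
          shiftedProd n N * (pole (m + N) - pole (n + N))) := by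
      rw [shiftedProd_succ, shiftedProd_succ]; ring
    rw [e]
    exact mul_mem (factor_mem N) (add_mem (mul_mem ih (pole_mem _))
      (mul_mem (shiftedProd_mem _ _) (pole_sub_pole_mem (by omega))))

/-- Rescaling by `1 / c` reduces this to the binomial series of `(1 - X)⁻¹ ^ (k + 1)`. -/
theorem coeff_geomInv_pow {c : ℝ} (k l : ℕ) : coeff l (geomInv c ^ (k + 1)) =
    (k + l).choose k * (1 / c) ^ (k + l + 1) := by
  have h : geomInv c = C (1 / c) * rescale (1 / c) (PowerSeries.mk 1) := by
    ext l
    rw [coeff_geomInv, coeff_C_mul, coeff_rescale, coeff_mk, Pi.one_apply]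
    ring
  rw [h, mul_pow, ← map_pow, ← map_pow, mk_one_pow_eq_mk_choose_add, coeff_C_mul, coeff_rescale,
    coeff_mk]
  ring

theorem coeff_coeff_doublePole (n k l : ℕ) : coeff l (coeff k (doublePole n)) =
    (k + l + 1).choose (k + 1) * (1 / ((n : ℝ) + 1) ^ (k + l + 2)) := by
  rw [doublePole, coeff_mk, coeff_geomInv_pow, one_div_pow]
  congr 3 <;> ring_nf

theorem doublePole_mem (n : ℕ) : doublePole n ∈ nonnegCoeffs := by
  intro k l
  rw [coeff_coeff_doublePole]
  positivity

/-! ### The zeta series and the remainder of the connected sum -/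

/-- The sum `∑_{n ≥ 1} 1 / n ^ p`. -/
def realZeta (p : ℕ) : ℝ := ∑' n : ℕ, 1 / ((n : ℝ) + 1) ^ p

theorem hasSum_realZeta {p : ℕ} (hp : 2 ≤ p) :
    HasSum (fun n : ℕ => 1 / ((n : ℝ) + 1) ^ p) (realZeta p) := by
  have h := (summable_nat_add_iff 1).2 (Real.summable_one_div_nat_pow.2 (show 1 < p by omega))
  push_cast at h
  exact h.hasSum

/-- The sum `∑_{n ≥ 1} 1 / ((n - x) (n - x - y))`. -/
def zetaSeries : ℝ⟦X⟧⟦X⟧ := PowerSeries.mk fun k => PowerSeries.mk fun l =>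
  (k + l + 1).choose (k + 1) * realZeta (k + l + 2)

theorem tendsto_sum_doublePole :
    Tendsto (fun M => ∑ m ∈ Finset.range M, doublePole m) atTop (𝓝 zetaSeries) := by
  rw [tendsto_iff_coeff_coeff]
  intro k l
  simp only [map_sum, coeff_coeff_doublePole, zetaSeries, coeff_mk]
  exact ((hasSum_realZeta (by omega)).mul_left _).tendsto_sum_nat

theorem tendsto_pole : Tendsto pole atTop (𝓝 0) := by
  rw [tendsto_iff_coeff_coeff]
  intro k l
  simp only [coeff_coeff_pole, map_zero]
  split_ifs
  · simpa using (tendsto_one_div_add_atTop_nhds_zero_nat (𝕜 := ℝ)).pow (l + 1)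
  · exact tendsto_const_nhds

theorem tendsto_sum_connectedTerm (N : ℕ) :
    Tendsto (fun m => ∑ n ∈ Finset.range N, connectedTerm n m) atTop (𝓝 0) := by
  rw [← Finset.sum_const_zero (s := Finset.range N)]
  refine tendsto_finsetSum _ fun n _ => ?_
  have hB : Tendsto (fun m => shiftedProd (m + 1) n) atTop
      (𝓝 (∏ j ∈ Finset.range n, ((j : ℝ⟦X⟧⟦X⟧) + 1 + yVar) * 0)) := by
    refine tendsto_finsetProd _ fun j _ => tendsto_const_nhds.mul ?_
    exact tendsto_pole.comp (tendsto_atTop_mono (fun m => by simp only [id]; omega) tendsto_id)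
  have h := (hB.const_mul (recip n)).mul tendsto_pole
  rwa [mul_zero] at h

theorem tendsto_sum_doublePole_mul (N : ℕ) :
    Tendsto (fun M => ∑ m ∈ Finset.range M, doublePole m * shiftedProd (m + 1) N) atTop
      (𝓝 (zetaSeries - ∑ n ∈ Finset.range N, connectedTerm n 0)) := by
  simp_rw [sum_doublePole_mul]
  simpa using tendsto_sum_doublePole.sub (tendsto_const_nhds.sub (tendsto_sum_connectedTerm N))

theorem mem_nonnegCoeffs_of_tendsto {f : ℕ → ℝ⟦X⟧⟦X⟧} {g : ℝ⟦X⟧⟦X⟧}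
    (h : Tendsto f atTop (𝓝 g)) (hf : ∀ n, f n ∈ nonnegCoeffs) : g ∈ nonnegCoeffs :=
  fun k l => ge_of_tendsto' (tendsto_iff_coeff_coeff.1 h k l) fun n => hf n k l

theorem zetaSeries_sub_mem (N : ℕ) :
    zetaSeries - ∑ n ∈ Finset.range N, connectedTerm n 0 ∈ nonnegCoeffs :=
  mem_nonnegCoeffs_of_tendsto (tendsto_sum_doublePole_mul N) fun _ =>
    sum_mem fun m _ => mul_mem (doublePole_mem m) (shiftedProd_mem _ _)

/-- In the remainder `∑_m doublePole m * shiftedProd (m + 1) N` each product is dominated by the one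
with `m = 0`. With `zetaSeries_sub_mem` this squeezes the remainder. -/
theorem zetaSeries_mul_sub_mem (N : ℕ) :
    zetaSeries * shiftedProd 1 N - (zetaSeries - ∑ n ∈ Finset.range N, connectedTerm n 0) ∈
      nonnegCoeffs := by
  refine mem_nonnegCoeffs_of_tendsto
    ((tendsto_sum_doublePole.mul_const _).sub (tendsto_sum_doublePole_mul N)) fun M => ?_
  rw [Finset.sum_mul, ← Finset.sum_sub_distrib]
  refine sum_mem fun m _ => ?_
  rw [← mul_sub]
  exact mul_mem (doublePole_mem m) (shiftedProd_sub_mem (by omega) N)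

theorem scalar_mul_coeff (c : ℝ) (f : ℝ⟦X⟧⟦X⟧) (k l : ℕ) :
    coeff l (coeff k (scalar c * f)) = c * coeff l (coeff k f) := by
  simp [scalar]

theorem shiftedProd_zero_eq (N : ℕ) :
    shiftedProd 0 N = map C (elementarySeries N) * C (completeSeries N) := by
  rw [elementarySeries, completeSeries, map_prod, map_prod, ← Finset.prod_mul_distrib, shiftedProd]
  refine Finset.prod_congr rfl fun j _ => ?_
  have h : (C (C (1 / ((j : ℝ) + 1))) : ℝ⟦X⟧⟦X⟧) * ((j : ℝ⟦X⟧⟦X⟧) + 1) = 1 := by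
    rw [mul_comm]; exact add_one_mul_recip j
  simp only [map_add, map_one, map_mul, map_C, map_X, map_natCast, zero_add, pole, yVar]
  linear_combination (-X * C (geomInv ((j : ℝ) + 1))) * h

theorem coeff_coeff_shiftedProd_zero (N k l : ℕ) : coeff l (coeff k (shiftedProd 0 N)) =
    coeff k (elementarySeries N) * coeff l (completeSeries N) := by
  rw [shiftedProd_zero_eq, coeff_mul_C, coeff_map, coeff_C_mul]

/-! ### Growth of the coefficients and vanishing of the remainders -/

theorem genHarmonic_one_succ (n : ℕ) :
    genHarmonic 1 (n + 1) = genHarmonic 1 n + 1 / ((n : ℝ) + 1) := by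
  simp [genHarmonic_eq_sum_range, Finset.sum_range_succ]

theorem genHarmonic_nonneg (r n : ℕ) : 0 ≤ genHarmonic r n :=
  Finset.sum_nonneg fun j _ => by positivity

theorem coeff_elementarySeries_bounds (n k : ℕ) :
    0 ≤ coeff k (elementarySeries n) ∧ coeff k (elementarySeries n) ≤ genHarmonic 1 n ^ k := by
  induction n generalizing k with
  | zero =>
    have := genHarmonic_nonneg 1 0
    simp only [elementarySeries, Finset.range_zero, Finset.prod_empty, coeff_one]
    split_ifs with h
    · simp [h]
    · exact ⟨le_rfl, by positivity⟩
  | succ n ih =>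
    have h0 := genHarmonic_nonneg 1 n
    have e : elementarySeries (n + 1) = elementarySeries n +
        C (1 / ((n : ℝ) + 1)) * (X * elementarySeries n) := by
      rw [elementarySeries, Finset.prod_range_succ, ← elementarySeries]; ring
    rw [e, map_add, coeff_C_mul, genHarmonic_one_succ]
    have hn : (0 : ℝ) ≤ 1 / ((n : ℝ) + 1) := by positivity
    cases k with
    | zero => simpa using ih 0
    | succ k =>
      rw [coeff_succ_X_mul]
      refine ⟨add_nonneg (ih _).1 (mul_nonneg hn (ih _).1), ?_⟩
      calc _ ≤ genHarmonic 1 n ^ (k + 1) + 1 / ((n : ℝ) + 1) * genHarmonic 1 n ^ k := by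
            gcongr
            · exact (ih _).2
            · exact (ih _).2
        _ = (genHarmonic 1 n) ^ k * (genHarmonic 1 n + 1 / ((n : ℝ) + 1)) := by ring
        _ ≤ (genHarmonic 1 n + 1 / ((n : ℝ) + 1)) ^ k *
            (genHarmonic 1 n + 1 / ((n : ℝ) + 1)) := by
            gcongr
            linarith
        _ = _ := by ring

theorem coeff_completeSeries_bounds (n l : ℕ) :
    0 ≤ coeff l (completeSeries n) ∧ coeff l (completeSeries n) ≤ genHarmonic 1 n ^ l := by
  induction n generalizing l with
  | zero =>
    have := genHarmonic_nonneg 1 0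
    simp only [completeSeries, Finset.range_zero, Finset.prod_empty, coeff_one]
    split_ifs with h
    · simp [h]
    · exact ⟨le_rfl, by positivity⟩
  | succ n ihn =>
    have h0 := genHarmonic_nonneg 1 n
    have hn : (0 : ℝ) ≤ 1 / ((n : ℝ) + 1) := by positivity
    -- The recurrence `h_{l+1}(n + 1) = h_{l+1}(n) + h_l(n + 1) / (n + 1)` has the new `n` on the
    -- right, hence the inner induction on `l`.
    have e : completeSeries (n + 1) = completeSeries n +
        C (1 / ((n : ℝ) + 1)) * (X * completeSeries (n + 1)) := by
      have hC : C (1 / ((n : ℝ) + 1)) * C ((n : ℝ) + 1) = (1 : ℝ⟦X⟧) := by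
        rw [← map_mul, one_div_mul_cancel (by positivity), map_one]
      have hg := sub_mul_geomInv (show (n : ℝ) + 1 ≠ 0 by positivity)
      rw [completeSeries, Finset.prod_range_succ, ← completeSeries]
      linear_combination completeSeries n * hg - completeSeries n * X * geomInv ((n : ℝ) + 1) * hC
    induction l with
    | zero =>
      rw [e, map_add, coeff_C_mul]
      simpa using ihn 0
    | succ l ihl =>
      rw [e, map_add, coeff_C_mul, coeff_succ_X_mul]
      refine ⟨add_nonneg (ihn _).1 (mul_nonneg hn ihl.1), ?_⟩
      rw [genHarmonic_one_succ] at ihl ⊢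
      calc _ ≤ genHarmonic 1 n ^ l * genHarmonic 1 n + 1 / ((n : ℝ) + 1) *
            (genHarmonic 1 n + 1 / ((n : ℝ) + 1)) ^ l := by
            rw [← pow_succ]
            gcongr
            · exact (ihn _).2
            · exact ihl.2
        _ ≤ (genHarmonic 1 n + 1 / ((n : ℝ) + 1)) ^ l * genHarmonic 1 n + 1 / ((n : ℝ) + 1) *
            (genHarmonic 1 n + 1 / ((n : ℝ) + 1)) ^ l := by
            gcongr
            linarith
        _ = _ := by ring

/-- The bound `1 + log (n + 1)` is packed into one logarithm so that `log ^ p = o(id)` applies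
directly along `e (n + 1)`. -/
theorem genHarmonic_one_le (n : ℕ) :
    genHarmonic 1 n ≤ Real.log (Real.exp 1 * ((n : ℝ) + 1)) := by
  have h : genHarmonic 1 n = (harmonic n : ℝ) := by
    simp [genHarmonic_eq_sum_range, harmonic]
  rw [h, Real.log_mul (Real.exp_pos 1).ne' (by positivity), Real.log_exp]
  refine (harmonic_le_one_add_log n).trans ?_
  rcases Nat.eq_zero_or_pos n with rfl | hn
  · simp
  · gcongr
    linarith

theorem tendsto_genHarmonic_pow_div (p : ℕ) :
    Tendsto (fun n : ℕ => 1 / ((n : ℝ) + 1) * genHarmonic 1 n ^ p) atTop (𝓝 0) := by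
  have h1 : Tendsto (fun n : ℕ => Real.exp 1 * ((n : ℝ) + 1)) atTop atTop :=
    Tendsto.const_mul_atTop (Real.exp_pos 1)
      (tendsto_atTop_add_const_right _ _ tendsto_natCast_atTop_atTop)
  have h2 := ((Real.isLittleO_pow_log_id_atTop (n := p)).tendsto_div_nhds_zero.comp h1).const_mul
    (Real.exp 1)
  rw [mul_zero] at h2
  refine squeeze_zero (fun n => ?_) (fun n => ?_) h2
  · have := genHarmonic_nonneg 1 n
    positivity
  · have h0 := genHarmonic_nonneg 1 n
    have := genHarmonic_one_le n
    calc _ ≤ 1 / ((n : ℝ) + 1) * Real.log (Real.exp 1 * ((n : ℝ) + 1)) ^ p := by gcongr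
      _ = _ := by
        simp only [Function.comp_apply, id]
        field_simp

theorem tendsto_recip_mul_shiftedProd :
    Tendsto (fun N => recip N * shiftedProd 0 N) atTop (𝓝 0) := by
  rw [tendsto_iff_coeff_coeff]
  intro k l
  simp only [recip, scalar_mul_coeff, coeff_coeff_shiftedProd_zero, map_zero]
  refine squeeze_zero (fun N => ?_) (fun N => ?_) (tendsto_genHarmonic_pow_div (k + l))
  · have := (coeff_elementarySeries_bounds N k).1
    have := (coeff_completeSeries_bounds N l).1
    positivity
  · have := genHarmonic_nonneg 1 N
    rw [pow_add]
    gcongr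
    · exact (coeff_completeSeries_bounds N l).1
    · exact (coeff_elementarySeries_bounds N k).2
    · exact (coeff_completeSeries_bounds N l).2

theorem tendsto_recip : Tendsto recip atTop (𝓝 0) := by
  rw [tendsto_iff_coeff_coeff]
  intro k l
  have h (n : ℕ) := scalar_mul_coeff (1 / ((n : ℝ) + 1)) 1 k l
  simp only [mul_one] at h
  simp only [recip, h, map_zero]
  simpa using (tendsto_one_div_add_atTop_nhds_zero_nat (𝕜 := ℝ)).mul_const
    (coeff l (coeff k (1 : ℝ⟦X⟧⟦X⟧)))

theorem tendsto_shiftedProd_one : Tendsto (shiftedProd 1) atTop (𝓝 0) := by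
  -- Here `shiftedProd 1 N = (1 - x) A_N / (N + 1 - x)`, and `1 / (N + 1 - x) = (1 + x / (N + 1 -
  -- x)) / (N + 1)` extracts the decaying factor `recip N`.
  have h : ∀ N, shiftedProd 1 N =
      (1 - xVar) * ((recip N * shiftedProd 0 N) * (1 + xVar * pole N)) := by
    intro N
    have h0 := sub_mul_pole 0
    have hN := sub_mul_pole N
    have hr := add_one_mul_recip N
    have hs := shiftedProd_succ_mul_pole 0 N
    simp only [zero_add, Nat.cast_zero] at h0 hs
    linear_combination (1 - xVar) * hs - shiftedProd 1 N * h0 +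
      (1 - xVar) * shiftedProd 0 N * (recip N * hN - pole N * hr)
  have := (tendsto_recip_mul_shiftedProd.mul
    ((tendsto_pole.const_mul xVar).const_add 1)).const_mul (1 - xVar)
  simp only [zero_mul, mul_zero] at this
  exact this.congr fun N => (h N).symm

theorem tendsto_sum_connectedTerm_zero :
    Tendsto (fun N => ∑ n ∈ Finset.range N, connectedTerm n 0) atTop (𝓝 zetaSeries) := by
  have h : Tendsto (fun N => zetaSeries - ∑ n ∈ Finset.range N, connectedTerm n 0) atTop
      (𝓝 0) := by
    have hV := tendsto_shiftedProd_one.const_mul zetaSeries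
    rw [mul_zero] at hV
    rw [tendsto_iff_coeff_coeff] at hV ⊢
    intro k l
    refine squeeze_zero (fun N => zetaSeries_sub_mem N k l) (fun N => ?_) (by simpa using hV k l)
    have := zetaSeries_mul_sub_mem N k l
    rw [map_sub, map_sub, sub_nonneg] at this
    exact this
  simpa using h.const_sub zetaSeries

theorem tendsto_boundary : Tendsto boundary atTop (𝓝 0) := by
  have h := tendsto_recip_mul_shiftedProd.mul
    (((tendsto_recip.comp (tendsto_add_atTop_nat 1)).const_mul (1 - yVar)).const_sub
      (xVar + yVar))
  rw [zero_mul] at h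
  refine h.congr fun N => ?_
  simp only [boundary, Function.comp_apply]
  ring

/-! ### The closed form of the generating function -/

/-- The generating function of the values of the series, in closed form. -/
def valueSeries : ℝ⟦X⟧⟦X⟧ :=
  scalar (1 / 2) * (scalar (1 / 2) + (xVar + yVar) * zetaSeries -
    PowerSeries.mk 1 * (xVar * ((xVar + yVar) * zetaSeries) + xVar + yVar))

theorem tendsto_sum_shiftedProd :
    Tendsto (fun N => ∑ n ∈ Finset.range N,
      shiftedProd 0 (n + 1) * recip n * recip (n + 1) * recip (n + 2)) atTop
      (𝓝 valueSeries) := by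
  -- The geometric series in `y` inverts `1 - y`; in the coefficients it produces the sums over `j`.
  have hG : (PowerSeries.mk 1 : ℝ⟦X⟧⟦X⟧) * (1 - yVar) = 1 := mk_one_mul_one_sub_eq_one _
  have h2 : scalar (1 / 2) * 2 = 1 := by
    rw [← map_ofNat scalar 2, ← map_mul]; norm_num
  have hr1 : recip 1 = scalar (1 / 2) := by rw [recip]; norm_num
  have hr0 : recip 0 = 1 := by rw [recip]; norm_num
  have h := (((tendsto_sum_connectedTerm_zero.const_mul ((xVar + yVar) * (1 - xVar - yVar))).add
    (tendsto_boundary.sub_const (boundary 0))).const_mul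
      (scalar (1 / 2) * (PowerSeries.mk 1 : ℝ⟦X⟧⟦X⟧)))
  have hb : boundary 0 = xVar + yVar - (1 - yVar) * scalar (1 / 2) := by
    rw [boundary, hr0, zero_add, hr1]; simp [shiftedProd]
  have hv : scalar (1 / 2) * (PowerSeries.mk 1 : ℝ⟦X⟧⟦X⟧) *
      ((xVar + yVar) * (1 - xVar - yVar) * zetaSeries + (0 - boundary 0)) = valueSeries := by
    rw [hb, valueSeries]
    linear_combination (scalar (1 / 2) * (scalar (1 / 2) + (xVar + yVar) * zetaSeries)) * hG
  rw [hv] at h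
  refine h.congr fun N => ?_
  rw [← two_mul_sum_shiftedProd]
  set S := ∑ n ∈ Finset.range N, shiftedProd 0 (n + 1) * recip n * recip (n + 1) * recip (n + 2)
  linear_combination S * hG + S * (PowerSeries.mk 1 : ℝ⟦X⟧⟦X⟧) * (1 - yVar) * h2

/-- The value of the sum of `Q_l P_k / (n (n + 1) (n + 2))`, as a coefficient. -/
theorem hasSum_evalHarmonic (k l : ℕ) :
    HasSum (fun n : ℕ => evalHarmonic (Q l) (n + 1) * evalHarmonic (P k) (n + 1) /
      (((n : ℝ) + 1) * ((n : ℝ) + 1 + 1) * ((n : ℝ) + 1 + 2)))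
      (coeff l (coeff k valueSeries)) := by
  rw [hasSum_iff_tendsto_nat_of_nonneg]
  · refine (tendsto_iff_coeff_coeff.1 tendsto_sum_shiftedProd k l).congr fun N => ?_
    rw [map_sum, map_sum]
    refine Finset.sum_congr rfl fun n _ => ?_
    have e : shiftedProd 0 (n + 1) * recip n * recip (n + 1) * recip (n + 2) =
        scalar (1 / ((n : ℝ) + 1) * (1 / (((n + 1 : ℕ) : ℝ) + 1)) *
          (1 / (((n + 2 : ℕ) : ℝ) + 1))) * shiftedProd 0 (n + 1) := by
      simp only [map_mul, recip]; ring
    rw [e, scalar_mul_coeff, coeff_coeff_shiftedProd_zero, evalHarmonic_Q_eq_coeff,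
      evalHarmonic_P_eq_coeff]
    push_cast
    rw [show (n : ℝ) + 2 + 1 = n + 1 + 2 by ring]
    field_simp
  · intro n
    rw [evalHarmonic_Q_eq_coeff, evalHarmonic_P_eq_coeff]
    have := (coeff_elementarySeries_bounds (n + 1) k).1
    have := (coeff_completeSeries_bounds (n + 1) l).1
    positivity

/-! ### Extraction of the coefficients -/

theorem coeff_xVar_mul_zero (f : ℝ⟦X⟧⟦X⟧) (k : ℕ) : coeff 0 (coeff k (xVar * f)) = 0 := by
  rw [xVar, coeff_C_mul, coeff_zero_X_mul]

theorem coeff_xVar_mul_succ (f : ℝ⟦X⟧⟦X⟧) (k l : ℕ) :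
    coeff (l + 1) (coeff k (xVar * f)) = coeff l (coeff k f) := by
  rw [xVar, coeff_C_mul, coeff_succ_X_mul]

theorem coeff_zetaSeries (k l : ℕ) : coeff l (coeff k zetaSeries) =
    (k + l + 1).choose (k + 1) * realZeta (k + l + 2) := by
  rw [zetaSeries, coeff_mk, coeff_mk]

/-- Pascal's rule merges the contributions of `x` and `y`. For `k = 0` the `y` contribution is
absent, which accounts for the subtracted `1`. -/
theorem coeff_add_mul_zetaSeries {k l : ℕ} (h : 1 ≤ k + l) :
    coeff l (coeff k ((xVar + yVar) * zetaSeries)) =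
      ((k + l + 1).choose (k + 1) - if k = 0 then 1 else 0) * realZeta (k + l + 1) := by
  rw [add_mul, map_add, map_add]
  rcases k with _ | k <;> rcases l with _ | l
  · omega
  · rw [coeff_xVar_mul_succ, coeff_zetaSeries, yVar, coeff_zero_X_mul, map_zero]
    simp only [zero_add, Nat.choose_one_right, if_pos]
    push_cast; ring_nf
  · rw [coeff_xVar_mul_zero, yVar, coeff_succ_X_mul, coeff_zetaSeries]
    simp
  · rw [coeff_xVar_mul_succ, yVar, coeff_succ_X_mul, coeff_zetaSeries, coeff_zetaSeries,
      show k + 1 + (l + 1) + 1 = (k + l + 2) + 1 by omega, Nat.choose_succ_succ (k + l + 2) (k + 1),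
      show k + 1 + l + 1 = k + l + 2 by omega, show k + (l + 1) + 1 = k + l + 2 by omega,
      show k + 1 + l + 2 = k + l + 3 by omega, show k + (l + 1) + 2 = k + l + 3 by omega]
    simp only [Nat.succ_eq_add_one, Nat.add_eq_zero_iff, one_ne_zero, and_false, if_false]
    push_cast; ring

theorem coeff_valueSeries {k l : ℕ} (h : 1 ≤ k + l) : coeff l (coeff k valueSeries) =
    1 / 2 * (((k + l + 1).choose (k + 1) - if k = 0 then 1 else 0) * realZeta (k + l + 1) -
      ∑ j ∈ Finset.range (k + 1), coeff l (coeff (k - j)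
        (xVar * ((xVar + yVar) * zetaSeries) + xVar + yVar))) := by
  have hconst : coeff l (coeff k (scalar (1 / 2))) = 0 := by
    rw [scalar, RingHom.comp_apply, coeff_C]
    split_ifs
    · rw [coeff_C, if_neg (by omega)]
    · simp
  rw [valueSeries, scalar_mul_coeff]
  simp only [map_sub]
  rw [map_add, map_add, hconst, zero_add, coeff_add_mul_zetaSeries h,
    coeff_mul, Finset.Nat.sum_antidiagonal_eq_sum_range_succ_mk]
  simp

theorem coeff_coeff_xVar (k l : ℕ) :
    coeff l (coeff k xVar) = if k = 0 ∧ l = 1 then 1 else 0 := by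
  rw [xVar, coeff_C]
  by_cases hk : k = 0 <;> simp [hk, coeff_X]

theorem coeff_coeff_yVar (k l : ℕ) :
    coeff l (coeff k yVar) = if k = 1 ∧ l = 0 then 1 else 0 := by
  rw [yVar, coeff_X]
  by_cases hk : k = 1 <;> simp [hk, coeff_one]

theorem coeff_valueSeries_of_two_le {k l : ℕ} (hl : 2 ≤ l) : coeff l (coeff k valueSeries) =
    1 / 2 * (((k + l + 1).choose (k + 1) - if k = 0 then 1 else 0) * realZeta (k + l + 1) -
      ∑ j ∈ Finset.range (k + 1), (k + l - j).choose (k + 1 - j) * realZeta (k + l - j) +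
      realZeta l) := by
  obtain ⟨l, rfl⟩ : ∃ l', l = l' + 1 := ⟨l - 1, by omega⟩
  have h : ∀ j ∈ Finset.range (k + 1), coeff (l + 1) (coeff (k - j)
      (xVar * ((xVar + yVar) * zetaSeries) + xVar + yVar)) =
      (k + (l + 1) - j).choose (k + 1 - j) * realZeta (k + (l + 1) - j) -
        -- At `j = k` the `y ^ 0` coefficient is read, where `coeff_add_mul_zetaSeries` subtracts
        -- one; this is the source of the extra `ζ(l)`.
        if j = k then realZeta (l + 1) else 0 := by
    intro j hj
    have hj' := Finset.mem_range.1 hj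
    rw [map_add, map_add, map_add, map_add, coeff_xVar_mul_succ,
      coeff_add_mul_zetaSeries (by omega), coeff_coeff_xVar, coeff_coeff_yVar,
      if_neg (show ¬(k - j = 0 ∧ l + 1 = 1) by omega),
      if_neg (show ¬(k - j = 1 ∧ l + 1 = 0) by omega), show k - j + l + 1 = k + (l + 1) - j by omega,
      show k - j + 1 = k + 1 - j by omega]
    by_cases hjk : j = k
    · subst hjk
      rw [if_pos (by omega), if_pos rfl, show j + (l + 1) - j = l + 1 by omega]
      ring
    · rw [if_neg (by omega), if_neg hjk]
      ring
  rw [coeff_valueSeries (by omega), Finset.sum_congr rfl h, Finset.sum_sub_distrib,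
    Finset.sum_ite_eq', if_pos (Finset.self_mem_range_succ k)]
  ring

theorem coeff_one_valueSeries (k : ℕ) : coeff 1 (coeff k valueSeries) =
    1 / 2 * ((k + 2 - if k = 0 then 1 else 0) * realZeta (k + 2) -
      ∑ j ∈ Finset.range k, realZeta (k + 1 - j) - 1) := by
  -- At `j = k` no zeta value arises, since `(x + y) Z` has no constant term; the lone `x` gives the
  -- `-1`.
  have h0 : coeff 1 (coeff 0 (xVar * ((xVar + yVar) * zetaSeries) + xVar + yVar)) = 1 := by
    rw [map_add, map_add, map_add, map_add, coeff_xVar_mul_succ, coeff_coeff_xVar,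
      coeff_coeff_yVar, add_mul, map_add, map_add, coeff_xVar_mul_zero, yVar, coeff_zero_X_mul]
    simp
  have h : ∀ j ∈ Finset.range k, coeff 1 (coeff (k - j)
      (xVar * ((xVar + yVar) * zetaSeries) + xVar + yVar)) = realZeta (k + 1 - j) := by
    intro j hj
    have hj' := Finset.mem_range.1 hj
    rw [map_add, map_add, map_add, map_add, coeff_xVar_mul_succ,
      coeff_add_mul_zetaSeries (by omega), coeff_coeff_xVar, coeff_coeff_yVar,
      if_neg (by omega), if_neg (by omega), if_neg (by omega), add_zero (k - j), Nat.choose_self,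
      show k - j + 1 = k + 1 - j by omega]
    simp
  rw [coeff_valueSeries (by omega), Finset.sum_range_succ, Finset.sum_congr rfl h, Nat.sub_self,
    h0, Nat.choose_succ_self_right]
  push_cast
  ring

theorem coeff_zero_valueSeries {k : ℕ} (hk : 1 ≤ k) : coeff 0 (coeff k valueSeries) =
    1 / 2 * (realZeta (k + 1) - 1) := by
  have h : ∀ j ∈ Finset.range (k + 1), coeff 0 (coeff (k - j)
      -- In degree `0` in `x` only the lone `y` survives, at `k - j = 1`.
      (xVar * ((xVar + yVar) * zetaSeries) + xVar + yVar)) = if j = k - 1 then 1 else 0 := by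
    intro j hj
    have hj' := Finset.mem_range.1 hj
    rw [map_add, map_add, map_add, map_add, coeff_xVar_mul_zero, coeff_coeff_xVar,
      coeff_coeff_yVar, if_neg (by omega), zero_add, zero_add]
    exact if_congr (by omega) rfl rfl
  rw [coeff_valueSeries (by omega), Finset.sum_congr rfl h, Finset.sum_ite_eq',
    if_pos (Finset.mem_range.2 (by omega)), if_neg (by omega), add_zero, Nat.choose_self]
  simp

theorem ofReal_realZeta {p : ℕ} (hp : 2 ≤ p) : ((realZeta p : ℝ) : ℂ) = riemannZeta (p : ℂ) := by
  have h := zeta_eq_tsum_one_div_nat_add_one_cpow (s := (p : ℂ)) (by simpa using by omega)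
  rw [h, realZeta, Complex.ofReal_tsum]
  simp

end HarmonicSum

end

theorem theorem5 (k l : ℕ) (hkl : 1 ≤ k + l) :
    HasSum
      (fun n : ℕ+ =>
        ((HarmonicSum.evalHarmonic (HarmonicSum.Q l) n *
            HarmonicSum.evalHarmonic (HarmonicSum.P k) n /
          ((n : ℝ) * ((n : ℝ) + 1) * ((n : ℝ) + 2)) : ℝ) : ℂ))
      (if 2 ≤ l then
        (1 / 2 : ℂ) *
          ((((k + l + 1).choose (k + 1) : ℂ) - (if k = 0 then 1 else 0)) *
              riemannZeta ((k + l + 1 : ℕ) : ℂ)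
            - ∑ j ∈ Finset.range (k + 1),
                ((k + l - j).choose (k + 1 - j) : ℂ) * riemannZeta ((k + l - j : ℕ) : ℂ)
            + riemannZeta (l : ℂ))
      else if l = 1 then
        (1 / 2 : ℂ) *
          (((k : ℂ) + 2 - (if k = 0 then 1 else 0)) * riemannZeta ((k + 2 : ℕ) : ℂ)
            - ∑ j ∈ Finset.range k, riemannZeta ((k + 1 - j : ℕ) : ℂ)
            - 1)
      else
        (1 / 2 : ℂ) * (riemannZeta ((k + 1 : ℕ) : ℂ) - 1)) := by
  have h := HarmonicSum.hasSum_evalHarmonic k l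
  -- The real series is indexed from `0` with `n + 1` as its variable; `natPred` passes to positive
  -- integers.
  rw [← Equiv.pnatEquivNat.hasSum_iff] at h
  have h' := Complex.hasSum_ofReal.2 h
  convert h' using 1
  · funext n
    have hn : ((n.natPred : ℕ) : ℝ) + 1 = n := by exact_mod_cast n.natPred_add_one
    simp [Function.comp, hn]
  · have hite : ((if k = 0 then (1 : ℝ) else 0 : ℝ) : ℂ) = if k = 0 then 1 else 0 := by
      split_ifs <;> simp
    by_cases h2 : 2 ≤ l
    · rw [if_pos h2, HarmonicSum.coeff_valueSeries_of_two_le h2,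
        ← HarmonicSum.ofReal_realZeta (show 2 ≤ k + l + 1 by omega),
        ← HarmonicSum.ofReal_realZeta h2, ← hite]
      have hs : ∀ j ∈ Finset.range (k + 1),
          ((k + l - j).choose (k + 1 - j) : ℂ) * riemannZeta ((k + l - j : ℕ) : ℂ) =
          ((k + l - j).choose (k + 1 - j) : ℂ) * (HarmonicSum.realZeta (k + l - j) : ℂ) := by
        intro j hj
        have := Finset.mem_range.1 hj
        rw [HarmonicSum.ofReal_realZeta (by omega)]
      rw [Finset.sum_congr rfl hs]
      push_cast
      rfl
    · by_cases h1 : l = 1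
      · subst h1
        rw [if_neg h2, if_pos rfl, HarmonicSum.coeff_one_valueSeries,
          ← HarmonicSum.ofReal_realZeta (show 2 ≤ k + 2 by omega), ← hite]
        have hs : ∀ j ∈ Finset.range k, riemannZeta ((k + 1 - j : ℕ) : ℂ) =
            (HarmonicSum.realZeta (k + 1 - j) : ℂ) := by
          intro j hj
          have := Finset.mem_range.1 hj
          rw [HarmonicSum.ofReal_realZeta (by omega)]
        rw [Finset.sum_congr rfl hs]
        push_cast
        rfl
      · obtain rfl : l = 0 := by omega
        rw [if_neg h2, if_neg h1, HarmonicSum.coeff_zero_valueSeries (by omega),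
          ← HarmonicSum.ofReal_realZeta (show 2 ≤ k + 1 by omega)]
        push_cast
        rfl
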